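/- **Setting.** Let $N,d,K,T$ be natural numbers, $\lambda>0$ and $\gamma_U,\gamma_D\ge 1$. On a probability space, at each time $t=1,\dots,T$ a (random) client $i_t\in\{1,\dots,N\}$ is active and is shown random context vectors $\mathbf x_{t,1},\dots,\mathbf x_{t,K}\in\mathbb R^d$ with $\|\mathbf x_{t,a}\|_2\le 1$ almost surely; it chooses one of them by an arbitrary rule (any measurable random choice), and the chosen vector is denoted $\mathbf x_t$. Let $\eta_t$ be the (real random) reward noise at time $t$. For a matrix $A\in\mathbb R^{d\times d}$ write $A(\lambda)=A+\lambda I$. **Protocol.** Every client $i$ keeps matrices $V_i$ and $\Delta V_i$ (upload buffer); the server keeps $V_g$ and, for every client $j$, a download buffer $\Delta V_{-j}$. All of them, for all $N$ clients, are $0$ at time $0$. At time $t$: 1. the active client adds $\mathbf x_t\mathbf x_t^\top$ to $V_{i_t}$ and to $\Delta V_{i_t}$; 2. if the upload event $\det V_{i_t}(\lambda)/\det\big((V_{i_t}-\Delta V_{i_t})(\lambda)\big)>\gamma_U$ happens, then $\Delta V_{i_t}$ is added to $V_g$ and to $\Delta V_{-j}$ for all $j\ne i_t$, then $\Delta V_{i_t}$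 is set to $0$, and then, for every client $j$ for which the download event $\det V_g(\lambda)/\det\big((V_g-\Delta V_{-j})(\lambda)\big)>\gamma_D$ happens, $\Delta V_{-j}$ is added to $V_j$ and set to $0$. If the upload event does not happen, nothing more is done at time $t$. Let $V_{i,t}$ be the value of $V_i$ at the end of time $t$, let $V_t=\sum_{s=1}^t\mathbf x_s\mathbf x_s^\top$, and $$\Gamma_{t-1}=\frac{\mathbf x_t^\top V_{i_t,t-1}(\lambda)^{-1}\mathbf x_t}{\mathbf x_t^\top V_{t-1}(\lambda)^{-1}\mathbf x_t}\qquad(\Gamma_{t-1}:=0\text{ if }\mathbf x_t=0).$$ **Context regularity.** There are a constant $\lambda_c>0$ and a matrix $\Sigma_c\succeq\lambda_c I$ such that for all $t\in\{1,\dots,T\}$ and all arms $a$, almost surely, $$\mathbb E\big[\mathbf x_{t,a}\mathbf x_{t,a}^\top\,\big|\,\{i_s,(\mathbf x_{s,1},\dots,\mathbf x_{s,K}),\eta_s\}_{1\le s\le t-1}\big]=\Sigma_c .$$ **Lemma 1.** Under these assumptions, for every $\delta\in(0,1)$, with probability at least $1-\delta$, $$\Gamma_{t-1}\le\frac{8\gamma_D}{\lambda_c}\,\big[1+(N-1)(\gamma_U-1)\big]\qquad\text{for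 all } t\in\{1,\dots,T\}\text{ simultaneously.}$$ -/

import Mathlib

open MeasureTheory

namespace AsyncBandit

/-- State of the event-triggered protocol with `N` clients in dimension `d`.
All stored matrices are unregularised sums of `x xᵀ`. (The vectors `b` are communicated together
with the matrices but influence neither the triggers nor the matrices.) -/
structure ProtocolState (N d : ℕ) where
  /-- local statistics `V_i` of client `i` -/
  V : Fin N → Matrix (Fin d) (Fin d) ℝ
  /-- upload buffer `ΔV_i` of client `i` -/
  up : Fin N → Matrix (Fin d) (Fin d) ℝ
  /-- the server's aggregated statistics `V_g` -/
  Vg : Matrix (Fin d) (Fin d) ℝ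
  /-- the server's download buffer `ΔV_{-j}` for client `j` -/
  down : Fin N → Matrix (Fin d) (Fin d) ℝ

variable {N d : ℕ}

/-- All clients, the server and all buffers start from zero. -/
def initState (N d : ℕ) : ProtocolState N d where
  V _ := 0
  up _ := 0
  Vg := 0
  down _ := 0

/-- The regularised matrix `V(lam) = V + lam I`. -/
def reg (lam : ℝ) (A : Matrix (Fin d) (Fin d) ℝ) : Matrix (Fin d) (Fin d) ℝ :=
  A + lam • (1 : Matrix (Fin d) (Fin d) ℝ)

/-- The rank-one matrix `x xᵀ`. -/
def outer (x : EuclideanSpace ℝ (Fin d)) : Matrix (Fin d) (Fin d) ℝ :=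
  Matrix.of fun j k => x j * x k

/-- The quadratic form `xᵀ A x`. -/
def quad (A : Matrix (Fin d) (Fin d) ℝ) (x : EuclideanSpace ℝ (Fin d)) : ℝ :=
  ∑ j, ∑ k, x j * A j k * x k

/-- The active client `i` adds `x xᵀ` to its statistics and to its upload buffer. -/
def ProtocolState.observe (S : ProtocolState N d) (i : Fin N) (x : EuclideanSpace ℝ (Fin d)) :
    ProtocolState N d where
  V := Function.update S.V i (S.V i + outer x)
  up := Function.update S.up i (S.up i + outer x)
  Vg := S.Vg
  down := S.down

/-- The upload event of client `i`: `det V_i / det (V_i - ΔV_i) > γU` (regularised). -/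
def ProtocolState.UploadEvent (S : ProtocolState N d) (lam γU : ℝ) (i : Fin N) : Prop :=
  γU < (reg lam (S.V i)).det / (reg lam (S.V i - S.up i)).det

/-- The download event of client `j`: `det V_g / det (V_g - ΔV_{-j}) > γD` (regularised). -/
def ProtocolState.DownloadEvent (S : ProtocolState N d) (lam γD : ℝ) (j : Fin N) : Prop :=
  γD < (reg lam S.Vg).det / (reg lam (S.Vg - S.down j)).det

/-- Client `i` sends its upload buffer: the server adds it to `V_g` and to the download buffers of
all the other clients, and the upload buffer is emptied. -/
def ProtocolState.upload (S : ProtocolState N d) (i : Fin N) : ProtocolState N d where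
  V := S.V
  up := Function.update S.up i 0
  Vg := S.Vg + S.up i
  down j := if j = i then S.down j else S.down j + S.up i

open Classical in
/-- Every client `j` whose download event happens receives its download buffer, which is
emptied. The events for different `j` do not influence each other. -/
noncomputable def ProtocolState.download (S : ProtocolState N d) (lam γD : ℝ) :
    ProtocolState N d where
  V j := if S.DownloadEvent lam γD j then S.V j + S.down j else S.V j
  up := S.up
  Vg := S.Vg
  down j := if S.DownloadEvent lam γD j then 0 else S.down j

open Classical in
/-- The communication protocol run after client `i` has been active: if the upload event
happens, client `i` uploads and then the server performs the triggered downloads. -/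
noncomputable def ProtocolState.communicate (S : ProtocolState N d) (lam γU γD : ℝ) (i : Fin N) :
    ProtocolState N d :=
  if S.UploadEvent lam γU i then (S.upload i).download lam γD else S

/-- The state at the end of time step `t` when at each time `s ≥ 1` client `i s` is active and its
chosen context vector is `x s`. -/
noncomputable def run (lam γU γD : ℝ) (i : ℕ → Fin N) (x : ℕ → EuclideanSpace ℝ (Fin d)) :
    ℕ → ProtocolState N d
  | 0 => initState N d
  | t + 1 => ((run lam γU γD i x t).observe (i (t + 1)) (x (t + 1))).communicate
      lam γU γD (i (t + 1))

/-- The centralised statistics `V_t = ∑_{s=1}^t x_s x_sᵀ`. -/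
def central (x : ℕ → EuclideanSpace ℝ (Fin d)) (t : ℕ) : Matrix (Fin d) (Fin d) ℝ :=
  ∑ s ∈ Finset.Icc 1 t, outer (x s)

/-- The width ratio at time `t ≥ 1` (the paper's `Γ_{t-1}`),
`xₜᵀ V_{iₜ,t-1}(lam)⁻¹ xₜ / xₜᵀ V_{t-1}(lam)⁻¹ xₜ`; it is `0` if `xₜ = 0`. -/
noncomputable def widthRatio (lam γU γD : ℝ) (i : ℕ → Fin N) (x : ℕ → EuclideanSpace ℝ (Fin d))
    (t : ℕ) : ℝ :=
  quad (reg lam ((run lam γU γD i x (t - 1)).V (i t)))⁻¹ (x t) /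
    quad (reg lam (central x (t - 1)))⁻¹ (x t)

/-- The history before time `t`: the σ-algebra generated by the active clients, the sets of
context vectors and the noises at the times `1, …, t - 1`. -/
def history {Ω : Type*} {K : ℕ} (i : ℕ → Ω → Fin N)
    (ctx : ℕ → Fin K → Ω → EuclideanSpace ℝ (Fin d)) (η : ℕ → Ω → ℝ) (t : ℕ) :
    MeasurableSpace Ω :=
  ⨆ s ∈ Finset.Ico 1 t,
    MeasurableSpace.comap (i s) inferInstance ⊔
    MeasurableSpace.comap (fun ω a => ctx s a ω) inferInstance ⊔
    MeasurableSpace.comap (η s) inferInstance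

/-- Context regularity up to the horizon `T`: for each arm and time, the conditional second moment
matrix of the context vector given the history is the constant matrix `Sig ⪰ lamc I`, `lamc > 0`. -/
structure ContextRegularity {Ω : Type*} [MeasurableSpace Ω] (P : Measure Ω) {K : ℕ} (T : ℕ)
    (i : ℕ → Ω → Fin N) (ctx : ℕ → Fin K → Ω → EuclideanSpace ℝ (Fin d)) (η : ℕ → Ω → ℝ)
    (Sig : Matrix (Fin d) (Fin d) ℝ) (lamc : ℝ) : Prop where
  lamc_pos : 0 < lamc
  psd : (Sig - lamc • (1 : Matrix (Fin d) (Fin d) ℝ)).PosSemidef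
  secondMoment : ∀ t ∈ Finset.Icc 1 T, ∀ a : Fin K, ∀ j k : Fin d,
    P[fun ω => ctx t a ω j * ctx t a ω k | history i ctx η t] =ᵐ[P] fun _ => Sig j k

end AsyncBandit

/-! The bound holds on every trajectory, even with `γD * (1 + (N - 1) * (γU - 1))` on the right.
Regularity enters only through `lamc ≤ 1`, which makes `8 / lamc` at least `1`.

If `A` is positive definite, `D ⪰ 0` and `det (A + D) / det A ≤ c`, then `A + D ⪯ c A`: normalise
`A` to the identity and note that a product of factors `≥ 1` dominates each of them. So an event
that does not fire gives a Loewner bound. Hence at the end of each step every upload buffer is at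
most `γU - 1` times the part its client shares with the server, and `Vg` is at most `γD` times that
part (`Balanced`).

The total is `Vg` plus all upload buffers. The `N - 1` foreign buffers cost the factor `1 + (N - 1)
* (γU - 1)`, and passing from `Vg` to the shared part costs `γD`; the client's own buffer already
lies in its `V`. Inverting reverses the order and bounds the width ratio. -/

open scoped MatrixOrder Matrix

namespace AsyncBandit

/-! ### Determinant ratios, inverses and the Loewner order -/

section LoewnerOrder

variable {n : Type*}

theorem smul_le_smul_of_loewner_le {A B : Matrix n n ℝ} {c : ℝ} (hc : 0 ≤ c) (h : A ≤ B) :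
    c • A ≤ c • B := by
  rw [Matrix.le_iff] at h ⊢
  rw [← smul_sub]
  exact h.smul hc

theorem smul_le_smul_of_nonneg_matrix {A : Matrix n n ℝ} {a b : ℝ} (hA : 0 ≤ A) (h : a ≤ b) :
    a • A ≤ b • A := by
  rw [Matrix.le_iff, ← sub_smul]
  exact (Matrix.nonneg_iff_posSemidef.1 hA).smul (sub_nonneg.2 h)

variable [Fintype n] [DecidableEq n]

/-- A positive semidefinite `M` satisfies `1 + M ≤ det (1 + M) • 1`. -/
theorem one_add_le_det_smul_one {M : Matrix n n ℝ} (hM : M.PosSemidef) :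
    1 + M ≤ (1 + M).det • (1 : Matrix n n ℝ) := by
  have hspec := hM.1.spectral_theorem
  rw [Unitary.conjStarAlgAut_apply] at hspec
  set U : Matrix n n ℝ := (hM.1.eigenvectorUnitary : Matrix n n ℝ) with hU
  set D : Matrix n n ℝ := Matrix.diagonal (RCLike.ofReal ∘ hM.1.eigenvalues) with hD
  have hUU : U * star U = 1 := Unitary.coe_mul_star_self _
  have hadd : 1 + M = U * (1 + D) * star U := by
    rw [mul_add, add_mul, mul_one, hUU, ← hspec]
  have hdiag : 1 + D = Matrix.diagonal fun k => 1 + hM.1.eigenvalues k := by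
    rw [hD, ← Matrix.diagonal_one, Matrix.diagonal_add]
    rfl
  have hdet : (1 + M).det = ∏ k, (1 + hM.1.eigenvalues k) := by
    have h1 : U.det * (star U).det = 1 := by rw [← Matrix.det_mul, hUU, Matrix.det_one]
    rw [hadd, Matrix.det_mul, Matrix.det_mul, mul_right_comm, h1, one_mul, hdiag,
      Matrix.det_diagonal]
  have hle : ∀ k, 1 + hM.1.eigenvalues k ≤ (1 + M).det := by
    intro k
    rw [hdet]
    -- The remaining factors are all at least `1`.
    rw [← Finset.mul_prod_erase _ _ (Finset.mem_univ k)]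
    exact le_mul_of_one_le_right (by linarith [hM.eigenvalues_nonneg k])
      (Finset.one_le_prod fun l _ => by linarith [hM.eigenvalues_nonneg l])
  have key : (1 + M).det • (1 : Matrix n n ℝ) - (1 + M) =
      U * (Matrix.diagonal fun k => (1 + M).det - (1 + hM.1.eigenvalues k)) * Uᴴ := by
    have h2 : (Matrix.diagonal fun k => (1 + M).det - (1 + hM.1.eigenvalues k)) =
        (1 + M).det • (1 : Matrix n n ℝ) - (1 + D) := by
      rw [hdiag, Matrix.smul_one_eq_diagonal, Matrix.diagonal_sub]
    rw [h2, mul_sub, sub_mul, ← Matrix.star_eq_conjTranspose, ← hadd, Matrix.mul_smul, mul_one,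
      Matrix.smul_mul, hUU]
  rw [Matrix.le_iff, key]
  exact (Matrix.PosSemidef.diagonal fun k => sub_nonneg.2 (hle k)).mul_mul_conjTranspose_same U

/-- A bound on the determinant ratio gives a bound in the Loewner order. -/
theorem add_le_smul_of_det_div_le {A D : Matrix n n ℝ} {c : ℝ} (hA : A.PosDef)
    (hD : D.PosSemidef) (h : (A + D).det / A.det ≤ c) : A + D ≤ c • A := by
  have hA0 : 0 ≤ A := Matrix.nonneg_iff_posSemidef.2 hA.posSemidef
  -- Conjugating by `A^(-1/2)` reduces to the case `A = 1`.
  set B : Matrix n n ℝ := CFC.sqrt A with hB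
  have hBB : B * B = A := CFC.sqrt_mul_sqrt_self A hA0
  have hBH : Bᴴ = B := (Matrix.nonneg_iff_posSemidef.1 (CFC.sqrt_nonneg A)).1
  have hdetB : B.det * B.det = A.det := by rw [← Matrix.det_mul, hBB]
  have hBu : IsUnit B.det := by
    rw [isUnit_iff_ne_zero]
    intro h0
    rw [h0, zero_mul] at hdetB
    exact hA.det_pos.ne hdetB
  have hBi : B * B⁻¹ = 1 := Matrix.mul_nonsing_inv B hBu
  have hiB : B⁻¹ * B = 1 := Matrix.nonsing_inv_mul B hBu
  have hM : (B⁻¹ * D * B⁻¹).PosSemidef := by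
    have h1 := hD.mul_mul_conjTranspose_same B⁻¹
    rwa [Matrix.conjTranspose_nonsing_inv, hBH] at h1
  have hfac : A + D = B * (1 + B⁻¹ * D * B⁻¹) * B := by
    have h1 : B * (B⁻¹ * D * B⁻¹) * B = (B * B⁻¹) * D * (B⁻¹ * B) := by
      simp only [Matrix.mul_assoc]
    rw [mul_add, add_mul, mul_one, hBB, h1, hBi, hiB, one_mul, mul_one]
  have hdet : (1 + B⁻¹ * D * B⁻¹).det = (A + D).det / A.det := by
    rw [eq_div_iff hA.det_pos.ne', hfac, Matrix.det_mul, Matrix.det_mul, ← hdetB]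
    ring
  have h1 := one_add_le_det_smul_one hM
  rw [hdet] at h1
  have h2 := h1.trans
    (smul_le_smul_of_nonneg_matrix (Matrix.nonneg_iff_posSemidef.2 Matrix.PosSemidef.one) h)
  rw [Matrix.le_iff] at h2 ⊢
  have h3 := h2.mul_mul_conjTranspose_same B
  rw [hBH, mul_sub, sub_mul, ← hfac, Matrix.mul_smul, mul_one, Matrix.smul_mul, hBB] at h3
  exact h3

/-- Inversion reverses a Loewner bound, at the level of quadratic forms. -/
theorem dotProduct_inv_mulVec_le {A B : Matrix n n ℝ} {c : ℝ} (hc : 0 < c) (hA : A.PosDef)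
    (hB : B.PosDef) (h : A ≤ c • B) (x : n → ℝ) :
    x ⬝ᵥ B⁻¹ *ᵥ x ≤ c * (x ⬝ᵥ A⁻¹ *ᵥ x) := by
  set u := B⁻¹ *ᵥ x with hu
  set v := A⁻¹ *ᵥ x with hv
  have hBu : B *ᵥ u = x := by
    rw [hu, Matrix.mulVec_mulVec,
      Matrix.mul_nonsing_inv _ ((Matrix.isUnit_iff_isUnit_det _).1 hB.isUnit), Matrix.one_mulVec]
  have hAv : A *ᵥ v = x := by
    rw [hv, Matrix.mulVec_mulVec,
      Matrix.mul_nonsing_inv _ ((Matrix.isUnit_iff_isUnit_det _).1 hA.isUnit), Matrix.one_mulVec]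
  have hAT : Aᵀ = A := by simpa [Matrix.IsSymm] using hA.1
  have h1 : u ⬝ᵥ A *ᵥ u ≤ c * (x ⬝ᵥ u) := by
    have h0 := (Matrix.le_iff.1 h).dotProduct_mulVec_nonneg u
    rw [star_trivial, Matrix.sub_mulVec, Matrix.smul_mulVec, hBu, dotProduct_sub,
      dotProduct_smul, smul_eq_mul, dotProduct_comm u x] at h0
    linarith
  -- Completing the square: this reads `uᵀAu - 2c xᵀu + c² xᵀv ≥ 0`, and `uᵀAu ≤ c xᵀu` by `h1`.
  have h2 := hA.posSemidef.dotProduct_mulVec_nonneg (u - c • v)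
  have h3 : v ⬝ᵥ A *ᵥ u = x ⬝ᵥ u := by
    rw [Matrix.dotProduct_mulVec, ← Matrix.mulVec_transpose, hAT, hAv]
  rw [star_trivial, Matrix.mulVec_sub, Matrix.mulVec_smul, hAv, dotProduct_sub, sub_dotProduct,
    sub_dotProduct, smul_dotProduct, smul_dotProduct, dotProduct_smul, dotProduct_smul, h3,
    dotProduct_comm u x, dotProduct_comm v x] at h2
  simp only [smul_eq_mul] at h2
  have h4 : 0 ≤ c * (c * (x ⬝ᵥ v) - x ⬝ᵥ u) := by linarith
  linarith [nonneg_of_mul_nonneg_right h4 hc]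

end LoewnerOrder

variable {N d : ℕ}

/-! ### Regularised matrices -/

theorem quad_eq_dotProduct (A : Matrix (Fin d) (Fin d) ℝ) (x : EuclideanSpace ℝ (Fin d)) :
    quad A x = (x : Fin d → ℝ) ⬝ᵥ A *ᵥ (x : Fin d → ℝ) := by
  simp only [quad, dotProduct, Matrix.mulVec, Finset.mul_sum, mul_assoc]

theorem outer_nonneg (x : EuclideanSpace ℝ (Fin d)) : 0 ≤ outer x := by
  have h : outer x = Matrix.vecMulVec (x : Fin d → ℝ) (star (x : Fin d → ℝ)) := rfl
  rw [Matrix.nonneg_iff_posSemidef, h]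
  exact Matrix.posSemidef_vecMulVec_self_star _

theorem reg_posDef {lam : ℝ} (hlam : 0 < lam) {A : Matrix (Fin d) (Fin d) ℝ} (hA : 0 ≤ A) :
    (reg lam A).PosDef :=
  Matrix.PosDef.posSemidef_add (Matrix.nonneg_iff_posSemidef.1 hA) (Matrix.PosDef.one.smul hlam)

theorem reg_nonneg {lam : ℝ} (hlam : 0 < lam) {A : Matrix (Fin d) (Fin d) ℝ} (hA : 0 ≤ A) :
    0 ≤ reg lam A :=
  Matrix.nonneg_iff_posSemidef.2 (reg_posDef hlam hA).posSemidef

theorem reg_add (lam : ℝ) (A B : Matrix (Fin d) (Fin d) ℝ) :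
    reg lam (A + B) = reg lam A + B := by
  simp only [reg]; abel

theorem reg_mono (lam : ℝ) {A B : Matrix (Fin d) (Fin d) ℝ} (h : A ≤ B) :
    reg lam A ≤ reg lam B :=
  add_le_add_left h _

theorem reg_add_le_of_det_div_le {lam c : ℝ} (hlam : 0 < lam) {A D : Matrix (Fin d) (Fin d) ℝ}
    (hA : 0 ≤ A) (hD : 0 ≤ D) (h : (reg lam (A + D)).det / (reg lam A).det ≤ c) :
    reg lam (A + D) ≤ c • reg lam A := by
  rw [reg_add] at h ⊢
  exact add_le_smul_of_det_div_le (reg_posDef hlam hA) (Matrix.nonneg_iff_posSemidef.1 hD) h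

/-! ### Invariants of the protocol -/

/-- The consistency of the buffers that holds at every moment of the protocol: `Vg - down j` is what
client `j` shares with the server. -/
structure Consistent (S : ProtocolState N d) : Prop where
  up_nonneg : ∀ j, 0 ≤ S.up j
  down_nonneg : ∀ j, 0 ≤ S.down j
  shared_nonneg : ∀ j, 0 ≤ S.Vg - S.down j
  V_eq : ∀ j, S.V j = S.Vg - S.down j + S.up j

/-- The buffer of client `j` is small compared with the statistics shared with the server. -/
def UploadBound (lam γU : ℝ) (S : ProtocolState N d) (j : Fin N) : Prop :=
  S.up j ≤ (γU - 1) • reg lam (S.Vg - S.down j)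

/-- The server's statistics are comparable with the part shared with client `j`. -/
def DownloadBound (lam γD : ℝ) (S : ProtocolState N d) (j : Fin N) : Prop :=
  reg lam S.Vg ≤ γD • reg lam (S.Vg - S.down j)

theorem Consistent.observe {S : ProtocolState N d} (h : Consistent S) (i : Fin N)
    (x : EuclideanSpace ℝ (Fin d)) : Consistent (S.observe i x) where
  up_nonneg j := by
    rcases eq_or_ne j i with rfl | hj
    · simpa [ProtocolState.observe] using add_nonneg (h.up_nonneg j) (outer_nonneg x)
    · simpa [ProtocolState.observe, hj] using h.up_nonneg j
  down_nonneg := h.down_nonneg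
  shared_nonneg := h.shared_nonneg
  V_eq j := by
    rcases eq_or_ne j i with rfl | hj
    · simp [ProtocolState.observe, h.V_eq j, add_assoc]
    · simp [ProtocolState.observe, hj, h.V_eq j]

/-- The uploader's shared part gains its buffer; for any other client `Vg` and the download buffer
grow equally. This monotonicity preserves old upload bounds. -/
theorem shared_le_shared_upload {S : ProtocolState N d} (h : Consistent S) (i j : Fin N) :
    S.Vg - S.down j ≤ (S.upload i).Vg - (S.upload i).down j := by
  rcases eq_or_ne j i with rfl | hj
  · simpa [ProtocolState.upload] using h.up_nonneg j
  · simp [ProtocolState.upload, hj]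

theorem Consistent.upload {S : ProtocolState N d} (h : Consistent S) (i : Fin N) :
    Consistent (S.upload i) where
  up_nonneg j := by
    rcases eq_or_ne j i with rfl | hj
    · simp [ProtocolState.upload]
    · simpa [ProtocolState.upload, hj] using h.up_nonneg j
  down_nonneg j := by
    rcases eq_or_ne j i with rfl | hj
    · simpa [ProtocolState.upload] using h.down_nonneg j
    · simpa [ProtocolState.upload, hj] using add_nonneg (h.down_nonneg j) (h.up_nonneg i)
  shared_nonneg j := (h.shared_nonneg j).trans (shared_le_shared_upload h i j)
  V_eq j := by
    rcases eq_or_ne j i with rfl | hj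
    · simp only [ProtocolState.upload, h.V_eq j, Function.update_self, if_true]
      abel
    · simp only [ProtocolState.upload, h.V_eq j, Function.update_of_ne hj, if_neg hj]
      abel

theorem shared_le_shared_download {S : ProtocolState N d} (h : Consistent S) (lam γD : ℝ)
    (j : Fin N) : S.Vg - S.down j ≤ (S.download lam γD).Vg - (S.download lam γD).down j := by
  by_cases hj : S.DownloadEvent lam γD j
  · simpa [ProtocolState.download, hj] using h.down_nonneg j
  · simp [ProtocolState.download, hj]

theorem Consistent.download {S : ProtocolState N d} (h : Consistent S) (lam γD : ℝ) :
    Consistent (S.download lam γD) where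
  up_nonneg := h.up_nonneg
  down_nonneg j := by
    by_cases hj : S.DownloadEvent lam γD j
    · simp [ProtocolState.download, hj]
    · simpa [ProtocolState.download, hj] using h.down_nonneg j
  shared_nonneg j := (h.shared_nonneg j).trans (shared_le_shared_download h lam γD j)
  V_eq j := by
    by_cases hj : S.DownloadEvent lam γD j
    · simp only [ProtocolState.download, hj, if_true, h.V_eq j]
      abel
    · simp [ProtocolState.download, hj, h.V_eq j]

/-- A triggered download makes the shared part all of `Vg`, so `1 ≤ γD` suffices; an untriggered one
leaves its determinant ratio at most `γD`. -/
theorem downloadBound_download {S : ProtocolState N d} {lam γD : ℝ} (hlam : 0 < lam)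
    (hγD : 1 ≤ γD) (h : Consistent S) (j : Fin N) :
    DownloadBound lam γD (S.download lam γD) j := by
  by_cases hj : S.DownloadEvent lam γD j
  · have hVg : 0 ≤ S.Vg := by
      simpa using add_nonneg (h.shared_nonneg j) (h.down_nonneg j)
    simpa [DownloadBound, ProtocolState.download, hj] using
      smul_le_smul_of_nonneg_matrix (reg_nonneg hlam hVg) hγD
  · have hj' := hj
    rw [ProtocolState.DownloadEvent, not_lt] at hj'
    simpa [DownloadBound, ProtocolState.download, hj] using
      reg_add_le_of_det_div_le (c := γD) hlam (h.shared_nonneg j) (h.down_nonneg j)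
        (by simpa using hj')

theorem uploadBound_of_not_uploadEvent {S : ProtocolState N d} {lam γU : ℝ} (hlam : 0 < lam)
    (h : Consistent S) {i : Fin N} (hi : ¬ S.UploadEvent lam γU i) : UploadBound lam γU S i := by
  rw [ProtocolState.UploadEvent, not_lt, h.V_eq i, add_sub_cancel_right] at hi
  have h1 := reg_add_le_of_det_div_le hlam (h.shared_nonneg i) (h.up_nonneg i) hi
  -- Removing one copy of the shared part turns `γU` into `γU - 1`.
  rw [reg_add, ← le_sub_iff_add_le'] at h1
  rwa [UploadBound, sub_smul, one_smul]

/-- What holds at the end of each time step. -/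
structure Balanced (lam γU γD : ℝ) (S : ProtocolState N d) : Prop extends Consistent S where
  uploadBound : ∀ j, UploadBound lam γU S j
  downloadBound : ∀ j, DownloadBound lam γD S j

theorem Balanced.step {S : ProtocolState N d} {lam γU γD : ℝ} (hlam : 0 < lam) (hγU : 1 ≤ γU)
    (hγD : 1 ≤ γD) (h : Balanced lam γU γD S) (i : Fin N) (x : EuclideanSpace ℝ (Fin d)) :
    Balanced lam γU γD ((S.observe i x).communicate lam γU γD i) := by
  have hγU' : 0 ≤ γU - 1 := sub_nonneg.2 hγU
  have hobs := h.toConsistent.observe i x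
  have hother : ∀ j, j ≠ i → UploadBound lam γU (S.observe i x) j := by
    intro j hj
    simpa [UploadBound, ProtocolState.observe, hj] using h.uploadBound j
  by_cases hU : (S.observe i x).UploadEvent lam γU i
  · rw [ProtocolState.communicate, if_pos hU]
    have hup := hobs.upload i
    refine ⟨hup.download lam γD, fun j => ?_, fun j => downloadBound_download hlam hγD hup j⟩
    have hmono := (shared_le_shared_upload hobs i j).trans (shared_le_shared_download hup lam γD j)
    rcases eq_or_ne j i with rfl | hj
    · have h0 : (((S.observe j x).upload j).download lam γD).up j = 0 := by
        simp [ProtocolState.download, ProtocolState.upload]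
      rw [UploadBound, h0]
      simpa using smul_le_smul_of_loewner_le hγU'
        (reg_nonneg hlam ((hup.download lam γD).shared_nonneg j))
    · have h0 : (((S.observe i x).upload i).download lam γD).up j = (S.observe i x).up j := by
        simp [ProtocolState.download, ProtocolState.upload, hj]
      rw [UploadBound, h0]
      exact (hother j hj).trans (smul_le_smul_of_loewner_le hγU' (reg_mono lam hmono))
  · rw [ProtocolState.communicate, if_neg hU]
    -- Without an upload, `Vg` and the download buffers do not move, so skipping the download test
    -- loses nothing.
    refine ⟨hobs, fun j => ?_, h.downloadBound⟩
    rcases eq_or_ne j i with rfl | hj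
    · exact uploadBound_of_not_uploadEvent hlam hobs hU
    · exact hother j hj

theorem balanced_initState {lam γU γD : ℝ} (hlam : 0 < lam) (hγU : 1 ≤ γU) (hγD : 1 ≤ γD) :
    Balanced lam γU γD (initState N d) := by
  have h0 : 0 ≤ reg lam (0 : Matrix (Fin d) (Fin d) ℝ) := reg_nonneg hlam le_rfl
  refine ⟨⟨fun _ => le_rfl, fun _ => le_rfl, fun _ => by simp [initState],
    fun _ => by simp [initState]⟩, fun _ => ?_, fun _ => ?_⟩
  · simpa [UploadBound, initState] using smul_le_smul_of_loewner_le (sub_nonneg.2 hγU) h0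
  · simpa [DownloadBound, initState] using smul_le_smul_of_nonneg_matrix h0 hγD

theorem balanced_run {lam γU γD : ℝ} (hlam : 0 < lam) (hγU : 1 ≤ γU) (hγD : 1 ≤ γD)
    (i : ℕ → Fin N) (x : ℕ → EuclideanSpace ℝ (Fin d)) (t : ℕ) :
    Balanced lam γU γD (run lam γU γD i x t) := by
  induction t with
  | zero => exact balanced_initState hlam hγU hγD
  | succ t ih => exact ih.step hlam hγU hγD _ _

/-! ### Conservation of the observations -/

theorem Vg_add_sum_up_observe (S : ProtocolState N d) (i : Fin N) (x : EuclideanSpace ℝ (Fin d)) :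
    (S.observe i x).Vg + ∑ j, (S.observe i x).up j = S.Vg + ∑ j, S.up j + outer x := by
  simp only [ProtocolState.observe]
  rw [Finset.sum_update_of_mem (Finset.mem_univ i), add_assoc S.Vg,
    ← Finset.add_sum_erase _ S.up (Finset.mem_univ i), Finset.sdiff_singleton_eq_erase]
  abel

theorem Vg_add_sum_up_upload (S : ProtocolState N d) (i : Fin N) :
    (S.upload i).Vg + ∑ j, (S.upload i).up j = S.Vg + ∑ j, S.up j := by
  simp only [ProtocolState.upload]
  rw [Finset.sum_update_of_mem (Finset.mem_univ i),
    ← Finset.add_sum_erase _ S.up (Finset.mem_univ i), Finset.sdiff_singleton_eq_erase]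
  abel

/-- The server's statistics and the upload buffers together contain every observation. -/
theorem Vg_add_sum_up_run (lam γU γD : ℝ) (i : ℕ → Fin N) (x : ℕ → EuclideanSpace ℝ (Fin d))
    (t : ℕ) : (run lam γU γD i x t).Vg + ∑ j, (run lam γU γD i x t).up j = central x t := by
  induction t with
  | zero => simp [run, initState, central]
  | succ t ih =>
    have hc : central x (t + 1) = central x t + outer (x (t + 1)) :=
      Finset.sum_Icc_succ_top (by omega) _
    rw [hc, ← ih, ← Vg_add_sum_up_observe _ (i (t + 1)), run, ProtocolState.communicate]
    split_ifs
    -- Downloads change neither `Vg` nor the upload buffers.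
    · exact Vg_add_sum_up_upload _ _
    · rfl

/-! ### The deterministic bound on the width ratio -/

theorem one_le_one_add_mul {N : ℕ} (i : Fin N) {γU : ℝ} (hγU : 1 ≤ γU) :
    1 ≤ 1 + ((N : ℝ) - 1) * (γU - 1) := by
  have hN : (1 : ℝ) ≤ N := by exact_mod_cast i.pos
  linarith [mul_nonneg (sub_nonneg.2 hN) (sub_nonneg.2 hγU)]

/-- All observations together are dominated by the statistics of any single client. -/
theorem Balanced.reg_total_le {S : ProtocolState N d} {lam γU γD : ℝ}
    (hγU : 1 ≤ γU) (hγD : 1 ≤ γD) (h : Balanced lam γU γD S) (i : Fin N) :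
    reg lam (S.Vg + ∑ j, S.up j) ≤
      (γD * (1 + ((N : ℝ) - 1) * (γU - 1))) • reg lam (S.V i) := by
  set c : ℝ := 1 + ((N : ℝ) - 1) * (γU - 1) with hc
  have hc1 : 1 ≤ c := one_le_one_add_mul i hγU
  have hup : ∀ j, S.up j ≤ (γU - 1) • reg lam S.Vg := fun j =>
    (h.uploadBound j).trans (smul_le_smul_of_loewner_le (sub_nonneg.2 hγU)
      (reg_mono lam (sub_le_self _ (h.down_nonneg j))))
  have hsum : ∑ j ∈ Finset.univ.erase i, S.up j ≤ (((N : ℝ) - 1) * (γU - 1)) • reg lam S.Vg := by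
    refine (Finset.sum_le_sum fun j _ => hup j).trans (le_of_eq ?_)
    rw [Finset.sum_const, Finset.card_erase_of_mem (Finset.mem_univ i), Finset.card_univ,
      Fintype.card_fin, ← Nat.cast_smul_eq_nsmul ℝ, smul_smul, Nat.cast_pred i.pos]
  calc reg lam (S.Vg + ∑ j, S.up j)
      = reg lam S.Vg + ∑ j ∈ Finset.univ.erase i, S.up j + S.up i := by
        rw [reg_add, ← Finset.add_sum_erase _ S.up (Finset.mem_univ i)]
        abel
    _ ≤ c • reg lam S.Vg + S.up i := by
        rw [hc, add_smul, one_smul]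
        gcongr
    _ ≤ (γD * c) • reg lam (S.Vg - S.down i) + (γD * c) • S.up i := by
        refine add_le_add ?_ ?_
        · rw [mul_comm, mul_smul]
          exact smul_le_smul_of_loewner_le (by linarith) (h.downloadBound i)
        · simpa using smul_le_smul_of_nonneg_matrix (h.up_nonneg i)
            (one_le_mul_of_one_le_of_one_le hγD hc1)
    _ = (γD * c) • reg lam (S.V i) := by rw [h.V_eq i, reg_add, smul_add]

/-- The width ratio is bounded along every trajectory of the protocol. -/
theorem widthRatio_le {lam γU γD : ℝ} (hlam : 0 < lam) (hγU : 1 ≤ γU) (hγD : 1 ≤ γD)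
    (i : ℕ → Fin N) (x : ℕ → EuclideanSpace ℝ (Fin d)) (t : ℕ) :
    widthRatio lam γU γD i x t ≤ γD * (1 + ((N : ℝ) - 1) * (γU - 1)) := by
  have hbal := balanced_run hlam hγU hγD i x (t - 1)
  have hle := hbal.reg_total_le hγU hγD (i t)
  rw [Vg_add_sum_up_run] at hle
  have hc : 0 < γD * (1 + ((N : ℝ) - 1) * (γU - 1)) :=
    mul_pos (by linarith) (by linarith [one_le_one_add_mul (i t) hγU])
  have hV : 0 ≤ (run lam γU γD i x (t - 1)).V (i t) := by
    rw [hbal.V_eq]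
    exact add_nonneg (hbal.shared_nonneg _) (hbal.up_nonneg _)
  have hA : (reg lam (central x (t - 1))).PosDef :=
    reg_posDef hlam (Finset.sum_nonneg fun s _ => outer_nonneg _)
  rw [widthRatio, quad_eq_dotProduct, quad_eq_dotProduct]
  -- The denominator need only be nonnegative: if `x t = 0`, the quotient is `0 / 0 = 0`.
  refine div_le_of_le_mul₀ ?_ hc.le
    (dotProduct_inv_mulVec_le hc hA (reg_posDef hlam hV) hle _)
  simpa using hA.inv.posSemidef.dotProduct_mulVec_nonneg (x t : Fin d → ℝ)

/-! ### Context regularity and the conclusion -/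

/-- Context vectors in the unit ball have a second moment matrix with an eigenvalue at most `1`. -/
theorem ContextRegularity.lamc_le_one {Ω : Type*} [MeasurableSpace Ω] {P : Measure Ω}
    [IsProbabilityMeasure P] {K T : ℕ} {i : ℕ → Ω → Fin N}
    {ctx : ℕ → Fin K → Ω → EuclideanSpace ℝ (Fin d)} {η : ℕ → Ω → ℝ}
    {Sig : Matrix (Fin d) (Fin d) ℝ} {lamc : ℝ} (h : ContextRegularity P T i ctx η Sig lamc)
    (hT : 1 ≤ T) (a : Fin K) (j : Fin d) (hctx_le : ∀ᵐ ω ∂P, ‖ctx 1 a ω‖ ≤ 1) : lamc ≤ 1 := by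
  have h1 : lamc ≤ Sig j j := by
    have h0 := h.psd.diag_nonneg (i := j)
    simpa using h0
  -- Nothing precedes time `1`, so the conditional expectation is an ordinary integral.
  have hbot : history i ctx η 1 = ⊥ := by simp [history]
  have h2 := h.secondMoment 1 (Finset.mem_Icc.2 ⟨le_rfl, hT⟩) a j j
  rw [hbot, condExp_bot] at h2
  obtain ⟨ω, hω⟩ := h2.exists
  have h3 : ∫ ω, ctx 1 a ω j * ctx 1 a ω j ∂P ≤ ∫ _, (1 : ℝ) ∂P := by
    refine integral_mono_of_nonneg (Filter.Eventually.of_forall fun ω => mul_self_nonneg _)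
      (integrable_const 1) ?_
    filter_upwards [hctx_le] with ω hω
    have h4 : ‖ctx 1 a ω j‖ ≤ 1 := (PiLp.norm_apply_le _ j).trans hω
    rw [Real.norm_eq_abs] at h4
    simpa [← sq] using (sq_le_one_iff_abs_le_one _).2 h4
  rw [integral_const, probReal_univ, one_smul] at h3
  linarith

end AsyncBandit

/-- For any clients' schedule and any way of choosing the arms, and for every `δ ∈ (0, 1)`, with
probability at least `1 - δ` the width ratio is bounded at all times `1 ≤ t ≤ T`. -/
theorem lemma1 {Ω : Type*} [MeasurableSpace Ω] (P : Measure Ω) [IsProbabilityMeasure P]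
    (N d K T : ℕ) (lam γU γD : ℝ) (hlam : 0 < lam) (hγU : 1 ≤ γU) (hγD : 1 ≤ γD)
    -- active clients, context vectors, noises, chosen arms
    (i : ℕ → Ω → Fin N) (hi : ∀ t, Measurable (i t))
    (ctx : ℕ → Fin K → Ω → EuclideanSpace ℝ (Fin d)) (hctx : ∀ t a, Measurable (ctx t a))
    (hctx_le : ∀ t a, ∀ᵐ ω ∂P, ‖ctx t a ω‖ ≤ 1)
    (η : ℕ → Ω → ℝ) (hη : ∀ t, Measurable (η t))
    (arm : ℕ → Ω → Fin K) (harm : ∀ t, Measurable (arm t))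
    (Sig : Matrix (Fin d) (Fin d) ℝ) (lamc : ℝ)
    (hreg : AsyncBandit.ContextRegularity P T i ctx η Sig lamc)
    (δ : ℝ) (hδ0 : 0 < δ) (hδ1 : δ < 1) :
    1 - δ ≤ P.real {ω | ∀ t ∈ Finset.Icc 1 T,
      AsyncBandit.widthRatio lam γU γD (fun s => i s ω) (fun s => ctx s (arm s ω) ω) t
        ≤ 8 * γD / lamc * (1 + ((N : ℝ) - 1) * (γU - 1))} := by
  have hall : ∀ ω, ∀ t ∈ Finset.Icc 1 T,
      AsyncBandit.widthRatio lam γU γD (fun s => i s ω) (fun s => ctx s (arm s ω) ω) t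
        ≤ 8 * γD / lamc * (1 + ((N : ℝ) - 1) * (γU - 1)) := by
    intro ω t ht
    have hpos := hreg.lamc_pos
    have hc := AsyncBandit.one_le_one_add_mul (i t ω) hγU
    -- In dimension `0` regularity puts no upper bound on `lamc`, but the ratio vanishes.
    rcases Nat.eq_zero_or_pos d with rfl | hd
    · have h0 : AsyncBandit.widthRatio lam γU γD (fun s => i s ω)
          (fun s => ctx s (arm s ω) ω) t = 0 := by
        simp [AsyncBandit.widthRatio, AsyncBandit.quad]
      rw [h0]
      exact mul_nonneg (div_nonneg (by linarith) hpos.le) (by linarith)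
    · have hT : 1 ≤ T := (Finset.mem_Icc.1 ht).1.trans (Finset.mem_Icc.1 ht).2
      have hlamc := hreg.lamc_le_one hT (arm t ω) ⟨0, hd⟩ (hctx_le 1 _)
      refine (AsyncBandit.widthRatio_le hlam hγU hγD _ _ t).trans ?_
      refine mul_le_mul_of_nonneg_right ?_ (by linarith)
      rw [le_div_iff₀ hpos]
      nlinarith
  rw [Set.eq_univ_of_forall (s := {ω | _}) hall, probReal_univ]
  linarith
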